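/- Let $\mathbb U=\{z\in\mathbb C:|z|<1\}$. For functions on $\mathbb U$ write $g\prec h$ if $g=h\circ\omega$ for some analytic $\omega:\mathbb U\to\mathbb U$ with $\omega(0)=0$. Let $p\ge 1$ be an integer, $\lambda,\alpha$ real with $|\lambda|<\pi/2$ and $0\le\alpha<1$, and $a,b$ non-zero complex numbers. Let $\mathcal A_p$ be the class of functions $f(z)=z^p+\sum_{k\ge p+1}a_kz^k$ analytic in $\mathbb U$, and let $\mathcal K_p^\lambda(\alpha,b)$ be the class of all $f\in\mathcal A_p$ such that $f'(z)\neq0$ for $0<|z|<1$ and $$\operatorname{Re}\left(\frac{1}{b\cos\lambda}\left[\frac{e^{i\lambda}}{p}\left(1+\frac{zf''(z)}{f'(z)}\right)-(1-b)\cos\lambda-i\sin\lambda\right]\right)>\alpha\qquad(z\in\mathbb U),$$ where $1+zf''(z)/f'(z)$ and $f'(z)/(pz^{p-1})$ take their limits $p$ and $1$ at $z=0$. Put $$c=2pab(1-\alpha)e^{-i\lambda}\cos\lambda,\qquad q(z)=\frac1{(1-z)^{c}}\ \text{ (principal power)},\qquad h(z)=\frac{1+(1-2\alpha)z}{1-z},$$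 and assume that $|c+1|\le1$ or $|c-1|\le1$. For a zero-free analytic function $g$ on $\mathbb U$ with $g(0)=1$, let $g^a=\exp(a\log g)$, where $\log g$ is the analytic branch on $\mathbb U$ with $\log g(0)=0$. Then: 1. If $f\in\mathcal K_p^\lambda(\alpha,b)$, then $\left(\dfrac{f'(z)}{pz^{p-1}}\right)^a\prec q(z)$. 2. Equivalently, if $f\in\mathcal A_p$, $f'(z)\ne0$ for $0<|z|<1$ and $$1+\frac{e^{i\lambda}}{b\cos\lambda}\left[\frac1p\left(1+\frac{zf''(z)}{f'(z)}\right)-1\right]\prec h(z),\tag{$*$}$$ then $\left(\dfrac{f'(z)}{pz^{p-1}}\right)^a\prec q(z)$; indeed, for $f\in\mathcal A_p$, the condition "$f'(z)\neq0$ for $0<|z|<1$ and $(*)$" is equivalent to $f\in\mathcal K_p^\lambda(\alpha,b)$. 3. The function $q$ is the best dominant of this differential subordination. That is, $q$ is analytic and injective in $\mathbb U$, $P\prec q$ for all $P\in S$, and $q\prec r$ for every analytic $r$ on $\mathbb U$ such that $P\prec r$ for all $P\in S$. This holds both when $S$ is the set of all functions $P=\left(f'(z)/(pz^{p-1})\right)^a$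 with $f$ as in part 2, and when $S$ is the set of all zero-free analytic functions $P$ on $\mathbb U$ with $P(0)=1$ and $$1+\frac{e^{i\lambda}}{pab\cos\lambda}\,\frac{zP'(z)}{P(z)}\prec h(z).$$ -/

import Mathlib

open Complex

namespace Robertson

/-- The open unit disc. -/
def unitDisc : Set ℂ := Metric.ball 0 1

/-- `g ≺ h`: `g = h ∘ ω` on the unit disc for an analytic self-map `ω` of the disc fixing `0`. -/
def Subordinate (g h : ℂ → ℂ) : Prop :=
  ∃ ω : ℂ → ℂ, DifferentiableOn ℂ ω unitDisc ∧ Set.MapsTo ω unitDisc unitDisc ∧ ω 0 = 0 ∧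
    ∀ z ∈ unitDisc, g z = h (ω z)

/-- Holomorphic and injective on the unit disc. -/
def Univalent (q : ℂ → ℂ) : Prop :=
  DifferentiableOn ℂ q unitDisc ∧ Set.InjOn q unitDisc

/-- Analytic functions `f(z) = z^p + ∑_{k ≥ p+1} a_k z^k` on the unit disc. -/
def classA (p : ℕ) : Set (ℂ → ℂ) :=
  {f | DifferentiableOn ℂ f unitDisc ∧
    ∃ a : ℕ → ℂ, ∀ z ∈ unitDisc, HasSum (fun k : ℕ => a k * z ^ (p + 1 + k)) (f z - z ^ p)}

/-- `f'` has no zero in the punctured disc, so that `z f''(z) / f'(z)` and a power of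
`f'(z) / (p z^(p-1))` make sense. -/
def DerivNonvanishing (f : ℂ → ℂ) : Prop :=
  ∀ z ∈ unitDisc, z ≠ 0 → deriv f z ≠ 0

/-- `1 + z f''(z) / f'(z)`, with its limit `p` at the removable singularity `0`. -/
noncomputable def convexityQuotient (p : ℕ) (f : ℂ → ℂ) (z : ℂ) : ℂ :=
  if z = 0 then (p : ℂ) else 1 + z * deriv (deriv f) z / deriv f z

/-- `f'(z) / (p z^(p-1))`, with its limit `1` at the removable singularity `0`. -/
noncomputable def derivQuotient (p : ℕ) (f : ℂ → ℂ) (z : ℂ) : ℂ :=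
  if z = 0 then 1 else deriv f z / (p * z ^ (p - 1))

/-- The class of multivalent `lam`-Robertson functions of complex order `b` and type `α`. -/
def classK (p : ℕ) (lam α : ℝ) (b : ℂ) : Set (ℂ → ℂ) :=
  {f | f ∈ classA p ∧ DerivNonvanishing f ∧ ∀ z ∈ unitDisc,
    α < ((1 / (b * Real.cos lam)) *
      (exp (I * lam) / p * convexityQuotient p f z
        - (1 - b) * Real.cos lam - I * Real.sin lam)).re}

/-- The map `(1 + (1 - 2α) z) / (1 - z)`. -/
noncomputable def halfPlaneMap (α : ℝ) (z : ℂ) : ℂ :=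
  (1 + (1 - 2 * (α : ℂ)) * z) / (1 - z)

/-- The same class condition written as a differential subordination for `f`. -/
def RobertsonSubordination (p : ℕ) (lam α : ℝ) (b : ℂ) (f : ℂ → ℂ) : Prop :=
  DerivNonvanishing f ∧
    Subordinate
      (fun z => 1 + exp (I * lam) / (b * Real.cos lam) * ((1 / p) * convexityQuotient p f z - 1))
      (halfPlaneMap α)

/-- `F = g^a` on the unit disc, where the power is `exp (a log g)` with the holomorphic branch
of `log g` on the disc that vanishes at `0`. Such a branch is unique, and it is the principal
logarithm as long as `g` does not meet the closed negative real axis. -/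
def IsNormalizedPower (g : ℂ → ℂ) (a : ℂ) (F : ℂ → ℂ) : Prop :=
  ∃ L : ℂ → ℂ, DifferentiableOn ℂ L unitDisc ∧ L 0 = 0 ∧
    (∀ z ∈ unitDisc, exp (L z) = g z) ∧ ∀ z ∈ unitDisc, F z = exp (a * L z)

/-- The two closed discs `|w + 1| ≤ 1` and `|w - 1| ≤ 1`. -/
def twoDiscs : Set ℂ := {w | ‖w + 1‖ ≤ 1 ∨ ‖w - 1‖ ≤ 1}

/-- `q` is a dominant of the set `S` of solutions. -/
def IsDominant (S : Set (ℂ → ℂ)) (q : ℂ → ℂ) : Prop :=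
  DifferentiableOn ℂ q unitDisc ∧ ∀ P ∈ S, Subordinate P q

/-- A univalent dominant that is subordinate to all dominants. -/
def IsBestDominant (S : Set (ℂ → ℂ)) (q : ℂ → ℂ) : Prop :=
  Univalent q ∧ IsDominant S q ∧ ∀ r : ℂ → ℂ, IsDominant S r → Subordinate q r

/-- The normalized, zero-free solutions `P` of the first-order differential subordination
`ψ(P(z), z P'(z)) ≺ h(z)`, with `ψ(r, s) = 1 + γ s / r`. -/
def solutions (γ : ℂ) (h : ℂ → ℂ) : Set (ℂ → ℂ) :=
  {P | DifferentiableOn ℂ P unitDisc ∧ P 0 = 1 ∧ (∀ z ∈ unitDisc, P z ≠ 0) ∧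
    Subordinate (fun z => 1 + γ * (z * deriv P z / P z)) h}

/-- The powers `(f'(z) / (p z^(p-1)))^a` for the functions `f` that satisfy the differential
subordination of the class. -/
def robertsonPowers (p : ℕ) (lam α : ℝ) (a b : ℂ) : Set (ℂ → ℂ) :=
  {F | ∃ f ∈ classA p, RobertsonSubordination p lam α b f ∧
    IsNormalizedPower (derivQuotient p f) a F}

/-- The exponent `2 p a b (1 - α) e^(-i lam) cos lam`. -/
noncomputable def robertsonExponent (p : ℕ) (lam α : ℝ) (a b : ℂ) : ℂ :=
  2 * p * a * b * (1 - α) * exp (-(I * lam)) * Real.cos lam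

/-- `1 / (1 - z)^c`, with the principal power. -/
noncomputable def powerDominant (c : ℂ) (z : ℂ) : ℂ := 1 / (1 - z) ^ c

end Robertson

/-!
Write `g = f' / (p z ^ (p - 1))`. Since `1 + z f'' / f' = p + z g' / g`, the class condition on `f`
says exactly that `P = g ^ a` satisfies `1 + γ z P' / P ≺ h`, where `γ c = 2 (1 - α)`. So
everything reduces to zero-free functions `P` with `P(0) = 1` under this subordination
(`robertsonPowers_subset_solutions`).

Let `M = log P / c`. As `h(w) = 1 + 2 (1 - α) w / (1 - w)`, the subordination gives
`Re (z M') > -1 / 2`. Put `ω = 1 - exp (-M)`, so that `z M' = z ω' / (1 - ω)`. If `‖ω‖` first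
reached `1` at `z₀`, Jack's lemma (`jack_lemma`) would give `z₀ ω'(z₀) = k ω(z₀)` with `k ≥ 1`
real, and `Re (z₀ M'(z₀)) = -k / 2`, a contradiction. Hence `ω` is a self-map of the disc
(`norm_one_sub_exp_neg_lt_one`), and `P = exp (c M) = (1 - ω) ^ (-c) = q ∘ ω`
(`subordinate_powerDominant_of_mem_solutions`).

The hypothesis on `c` serves only to make `q` univalent (`univalent_powerDominant`): it says that
`|Re (1 / c)| ≥ 1 / 2`, so that the periods `2πin / c` of `s ↦ exp (-c s)` have imaginary parts
at least `π` in absolute value for `n ≠ 0`, and cannot be differences of two values of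
`log (1 - z)`, whose imaginary parts lie in `(-π / 2, π / 2)`.

Finally, `q` is best because it belongs to both families: `ω = id` works for the solutions
(`powerDominant_mem_solutions`), and integrating `f' = p z ^ (p - 1) (1 - z) ^ (-c / a)` gives an
`f` in the class whose power is `q` (`powerDominant_mem_robertsonPowers`).
-/

namespace Robertson

open Filter Topology

/-! ### The unit disc, primitives and logarithms -/

theorem isOpen_unitDisc : IsOpen unitDisc := Metric.isOpen_ball

theorem isPreconnected_unitDisc : IsPreconnected unitDisc :=
  (convex_ball (0 : ℂ) 1).isPreconnected

theorem zero_mem_unitDisc : (0 : ℂ) ∈ unitDisc := Metric.mem_ball_self one_pos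

theorem mem_unitDisc {z : ℂ} : z ∈ unitDisc ↔ ‖z‖ < 1 := mem_ball_zero_iff

theorem ne_one_of_mem_unitDisc {z : ℂ} (hz : z ∈ unitDisc) : z ≠ 1 := by
  rintro rfl
  simp [mem_unitDisc] at hz

theorem one_sub_re_pos {z : ℂ} (hz : z ∈ unitDisc) : 0 < (1 - z).re := by
  have h := (Complex.re_le_norm z).trans_lt (mem_unitDisc.1 hz)
  simpa using h

theorem exists_primitive {f : ℂ → ℂ} (hf : DifferentiableOn ℂ f unitDisc) :
    ∃ g : ℂ → ℂ, g 0 = 0 ∧ ∀ z ∈ unitDisc, HasDerivAt g (f z) z :=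
  (DifferentiableOn.isExactOn_ball hf).with_val_at 0 0

/-- A primitive `L` of `g' / g` makes `g exp (-L)` constant. -/
theorem exists_normalized_log {g : ℂ → ℂ} (hg : DifferentiableOn ℂ g unitDisc) (h0 : g 0 = 1)
    (hne : ∀ z ∈ unitDisc, g z ≠ 0) :
    ∃ L : ℂ → ℂ, DifferentiableOn ℂ L unitDisc ∧ L 0 = 0 ∧ ∀ z ∈ unitDisc, exp (L z) = g z := by
  obtain ⟨L, hL0, hL⟩ := exists_primitive ((hg.deriv isOpen_unitDisc).div hg hne)
  refine ⟨L, fun z hz => (hL z hz).differentiableAt.differentiableWithinAt, hL0, fun z hz => ?_⟩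
  have hd : ∀ w ∈ unitDisc, HasDerivAt (fun w => g w * exp (-L w)) 0 w := by
    intro w hw
    have h1 := (hg.differentiableAt (isOpen_unitDisc.mem_nhds hw)).hasDerivAt
    refine (h1.mul (hL w hw).neg.cexp).congr_deriv ?_
    have h2 := hne w hw
    have h3 : (deriv g / g) w * g w = deriv g w := div_mul_cancel₀ _ h2
    linear_combination -exp (-L w) * h3
  have hconst : g z * exp (-L z) = 1 := by
    have := isOpen_unitDisc.is_const_of_deriv_eq_zero isPreconnected_unitDisc
      (fun w hw => (hd w hw).differentiableAt.differentiableWithinAt)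
      (fun w hw => (hd w hw).deriv) hz zero_mem_unitDisc
    simpa [h0, hL0] using this
  rw [exp_neg] at hconst
  field_simp at hconst
  exact hconst.symm

theorem eqOn_of_exp_eq {L₁ L₂ : ℂ → ℂ} (h₁ : DifferentiableOn ℂ L₁ unitDisc)
    (h₂ : DifferentiableOn ℂ L₂ unitDisc) (h0 : L₁ 0 = L₂ 0)
    (hexp : ∀ z ∈ unitDisc, exp (L₁ z) = exp (L₂ z)) : Set.EqOn L₁ L₂ unitDisc := by
  refine isOpen_unitDisc.eqOn_of_deriv_eq isPreconnected_unitDisc h₁ h₂ (fun z hz => ?_)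
    zero_mem_unitDisc h0
  have hd₁ := (h₁.differentiableAt (isOpen_unitDisc.mem_nhds hz)).hasDerivAt.cexp
  have hd₂ := (h₂.differentiableAt (isOpen_unitDisc.mem_nhds hz)).hasDerivAt.cexp
  have := hd₁.unique (hd₂.congr_of_eventuallyEq ((isOpen_unitDisc.eventually_mem hz).mono hexp))
  rw [hexp z hz] at this
  exact mul_left_cancel₀ (exp_ne_zero _) this

/-! ### Jack's lemma -/

/-- **Jack's lemma**. Comparison of `‖φ‖` with `‖z‖ / r` (Schwarz) in the radial direction gives
`1 ≤ k`, and maximality of `‖φ‖` on the circle makes `k` real. -/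
theorem jack_lemma {φ : ℂ → ℂ} {r : ℝ} {z₀ : ℂ} (hr : 0 < r) (hz₀ : ‖z₀‖ = r)
    (hd : DifferentiableOn ℂ φ (Metric.ball 0 r)) (hd₀ : DifferentiableAt ℂ φ z₀) (h0 : φ 0 = 0)
    (hle : ∀ z, ‖z‖ ≤ r → ‖φ z‖ ≤ 1) (h1 : ‖φ z₀‖ = 1) :
    ∃ k : ℝ, 1 ≤ k ∧ z₀ * deriv φ z₀ = k * φ z₀ := by
  have hφ : φ z₀ ≠ 0 := by
    rw [← norm_ne_zero_iff, h1]
    exact one_ne_zero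
  set κ : ℂ := z₀ * deriv φ z₀ / φ z₀ with hκ
  have hκ' : z₀ * deriv φ z₀ = κ * φ z₀ := by rw [hκ, div_mul_cancel₀ _ hφ]
  have hschwarz : ∀ z, ‖z‖ ≤ r → ‖φ z‖ ≤ ‖z‖ / r := by
    intro z hz
    rcases hz.lt_or_eq with hz' | hz'
    · have := dist_le_div_mul_dist_of_mapsTo_ball (R₂ := 1) hd
        (fun w hw => by simpa [h0] using hle w (mem_ball_zero_iff.1 hw).le)
        (mem_ball_zero_iff.2 hz')
      simpa [h0, div_eq_inv_mul] using this
    · rw [hz', div_self hr.ne']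
      exact hle z hz
  -- In the coordinate `z = z₀ exp s` the disc is the half-plane `s.re ≤ 0`, with `s = 0` at `z₀`.
  have hψ : HasDerivAt (fun s : ℂ => φ (z₀ * exp s)) (κ * φ z₀) 0 := by
    have h2 : HasDerivAt (fun s : ℂ => z₀ * exp s) z₀ 0 := by
      simpa using (Complex.hasDerivAt_exp 0).const_mul z₀
    have h3 : HasDerivAt φ (deriv φ z₀) (z₀ * exp 0) := by simpa using hd₀.hasDerivAt
    rw [← hκ', mul_comm z₀]
    exact h3.comp 0 h2
  have hψF := hψ.hasFDerivAt.restrictScalars ℝ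
  have hn := hψF.norm_sq
  have hre : HasFDerivAt (fun s : ℂ => Real.exp (2 * s.re)) ((2 : ℝ) • Complex.reCLM) 0 := by
    have := ((Complex.reCLM.hasFDerivAt (x := (0 : ℂ))).const_mul (2 : ℝ)).exp
    simpa using this
  have hmax : IsLocalMaxOn
      (fun s : ℂ => ‖φ (z₀ * exp s)‖ ^ 2 - Real.exp (2 * s.re)) {s : ℂ | s.re ≤ 0} 0 := by
    refine IsMaxOn.localize fun s hs => ?_
    have hs' : s.re ≤ 0 := hs
    have hnorm : ‖z₀ * exp s‖ = r * Real.exp s.re := by rw [norm_mul, hz₀, Complex.norm_exp]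
    have h4 : ‖φ (z₀ * exp s)‖ ≤ Real.exp s.re := by
      have := hschwarz (z₀ * exp s) (by
        rw [hnorm]
        exact mul_le_of_le_one_right hr.le (Real.exp_le_one_iff.2 hs'))
      rwa [hnorm, mul_div_cancel_left₀ _ hr.ne'] at this
    have h5 : Real.exp (2 * s.re) = Real.exp s.re ^ 2 := by
      rw [← Real.exp_nat_mul]
      norm_num
    have h6 : ‖φ (z₀ * exp s)‖ ^ 2 ≤ Real.exp s.re ^ 2 := by gcongr
    simp only [Set.mem_ofPred_eq, h5, exp_zero, mul_one, h1, zero_re, mul_zero, Real.exp_zero]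
    linarith
  have hconv : Convex ℝ {s : ℂ | s.re ≤ 0} := convex_halfSpace_re_le 0
  have key : ∀ y : ℂ, y.re ≤ 0 → 2 * (κ * y).re - 2 * y.re ≤ 0 := by
    intro y hy
    have := hmax.hasFDerivWithinAt_nonpos (hn.sub hre).hasFDerivWithinAt (y := y)
      (mem_posTangentConeAt_of_segment_subset (hconv.segment_subset (by simp) (by simpa using hy)))
    have h7 : (starRingEnd ℂ) (φ z₀) * φ z₀ = 1 := by
      rw [mul_comm, Complex.mul_conj, Complex.normSq_eq_norm_sq, h1]
      simp
    have h8 : inner ℝ (φ z₀) (y * (κ * φ z₀)) = (κ * y).re := by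
      rw [Complex.inner]
      congr 1
      linear_combination κ * y * h7
    simpa [h8] using this
  have hk1 := key (-1) (by simp)
  have hk2 := key I (by simp)
  have hk3 := key (-I) (by simp)
  simp at hk1 hk2 hk3
  refine ⟨κ.re, by linarith, ?_⟩
  rw [hκ']
  congr 1
  apply Complex.ext <;> simp
  linarith

theorem re_div_one_sub {w : ℂ} (hw : w ≠ 1) :
    (w / (1 - w)).re = -1 / 2 + (1 - ‖w‖ ^ 2) / (2 * ‖1 - w‖ ^ 2) := by
  have h : (1 - w.re) * (1 - w.re) + w.im * w.im ≠ 0 := by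
    have := Complex.normSq_eq_zero.not.2 (sub_ne_zero.2 hw.symm)
    simpa [Complex.normSq_apply] using this
  rw [Complex.div_re, ← Complex.normSq_eq_norm_sq, ← Complex.normSq_eq_norm_sq]
  simp only [Complex.normSq_apply, Complex.sub_re, Complex.sub_im, Complex.one_re, Complex.one_im,
    zero_sub, neg_mul_neg]
  generalize hD : (1 - w.re) * (1 - w.re) + w.im * w.im = D at h ⊢
  field_simp
  rw [← hD]
  ring

/-- At a first point where `‖1 - exp (-M)‖` reaches `1`, Jack's lemma makes `z M' = k ω / (1 - ω)`
with `‖ω‖ = 1` and `1 ≤ k`, whose real part is `-k / 2`. -/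
theorem norm_one_sub_exp_neg_lt_one {M : ℂ → ℂ} (hM : DifferentiableOn ℂ M unitDisc)
    (h0 : M 0 = 0) (hre : ∀ z ∈ unitDisc, -1 / 2 < (z * deriv M z).re) :
    ∀ z ∈ unitDisc, ‖1 - exp (-M z)‖ < 1 := by
  by_contra! hcon
  obtain ⟨z₁, hz₁, hbig⟩ := hcon
  set φ : ℂ → ℂ := fun z => 1 - exp (-M z) with hφdef
  have hφd : DifferentiableOn ℂ φ unitDisc := hM.neg.cexp.const_sub 1
  have hφ0 : φ 0 = 0 := by simp [hφdef, h0]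
  have hsub : Metric.closedBall (0 : ℂ) ‖z₁‖ ⊆ unitDisc :=
    Metric.closedBall_subset_ball (mem_unitDisc.1 hz₁)
  have hcont : ContinuousOn (fun z => ‖φ z‖) (Metric.closedBall 0 ‖z₁‖) :=
    (hφd.continuousOn.mono hsub).norm
  -- A point `z₀` of least modulus with `1 ≤ ‖φ z₀‖`.
  have hK : IsCompact (Metric.closedBall (0 : ℂ) ‖z₁‖ ∩ (fun z => ‖φ z‖) ⁻¹' Set.Ici 1) :=
    (isCompact_closedBall _ _).of_isClosed_subset
      (hcont.preimage_isClosed_of_isClosed Metric.isClosed_closedBall isClosed_Ici)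
      Set.inter_subset_left
  obtain ⟨z₀, ⟨hz₀b, hz₀1⟩, hmin⟩ := hK.exists_isMinOn
    ⟨z₁, by simp, hbig⟩ continuous_norm.continuousOn
  have hz₀1' : 1 ≤ ‖φ z₀‖ := hz₀1
  have hz₀U := hsub hz₀b
  have hz₀ne : z₀ ≠ 0 := by
    rintro rfl
    norm_num [hφ0] at hz₀1'
  have hr : 0 < ‖z₀‖ := norm_pos_iff.2 hz₀ne
  have hlt : ∀ z ∈ Metric.ball (0 : ℂ) ‖z₀‖, ‖φ z‖ ≤ 1 := by
    intro z hz
    by_contra! h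
    have hz' := mem_ball_zero_iff.1 hz
    exact absurd (hmin ⟨mem_closedBall_zero_iff.2 (hz'.le.trans (mem_closedBall_zero_iff.1 hz₀b)),
      h.le⟩) (not_le.2 hz')
  have hsub₀ : Metric.closedBall (0 : ℂ) ‖z₀‖ ⊆ unitDisc :=
    Metric.closedBall_subset_ball (mem_unitDisc.1 hz₀U)
  have hle : ∀ z, ‖z‖ ≤ ‖z₀‖ → ‖φ z‖ ≤ 1 := by
    intro z hz
    have hcl : closure (Metric.ball (0 : ℂ) ‖z₀‖) = Metric.closedBall 0 ‖z₀‖ :=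
      closure_ball _ hr.ne'
    refine le_on_closure (f := fun z => ‖φ z‖) (g := fun _ => 1) hlt ?_ continuousOn_const
      (x := z) ?_
    · rw [hcl]
      exact (hφd.continuousOn.mono hsub₀).norm
    · rw [hcl]
      exact mem_closedBall_zero_iff.2 hz
  have hone : ‖φ z₀‖ = 1 := le_antisymm (hle z₀ le_rfl) hz₀1'
  have hMd := (hM.differentiableAt (isOpen_unitDisc.mem_nhds hz₀U)).hasDerivAt
  have hφD : HasDerivAt φ (exp (-M z₀) * deriv M z₀) z₀ := by
    simpa using hMd.neg.cexp.const_sub 1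
  obtain ⟨k, hk, hkeq⟩ := jack_lemma hr rfl
    (hφd.mono (Metric.ball_subset_closedBall.trans hsub₀)) hφD.differentiableAt hφ0 hle hone
  have hexp : exp (-M z₀) = 1 - φ z₀ := by simp [hφdef]
  have hne : 1 - φ z₀ ≠ 0 := hexp ▸ exp_ne_zero _
  have hne1 : φ z₀ ≠ 1 := fun h => hne (by rw [h, sub_self])
  rw [hφD.deriv, hexp] at hkeq
  have hzM : z₀ * deriv M z₀ = k * (φ z₀ / (1 - φ z₀)) := by
    rw [← mul_div_assoc, eq_div_iff hne, ← hkeq]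
    ring
  have := hre z₀ hz₀U
  rw [hzM, Complex.re_ofReal_mul, re_div_one_sub hne1, hone] at this
  norm_num at this
  linarith

/-! ### Subordination to the half-plane map -/

theorem halfPlaneMap_eq (α : ℝ) {w : ℂ} (hw : w ≠ 1) :
    halfPlaneMap α w = 1 + 2 * (1 - α) * (w / (1 - w)) := by
  have : 1 - w ≠ 0 := sub_ne_zero.2 hw.symm
  rw [halfPlaneMap]
  field_simp
  ring

theorem lt_re_of_subordinate_halfPlaneMap {α : ℝ} (hα : α < 1) {g : ℂ → ℂ}
    (h : Subordinate g (halfPlaneMap α)) : ∀ z ∈ unitDisc, α < (g z).re := by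
  obtain ⟨ω, -, hmaps, -, heq⟩ := h
  intro z hz
  have hw := hmaps hz
  have hw1 := ne_one_of_mem_unitDisc hw
  have hpos : 0 < (1 - ‖ω z‖ ^ 2) / (2 * ‖1 - ω z‖ ^ 2) := by
    have h1 := mem_unitDisc.1 hw
    have h2 : 0 < ‖1 - ω z‖ := norm_pos_iff.2 (sub_ne_zero.2 hw1.symm)
    have h3 : 0 < 1 - ‖ω z‖ ^ 2 := by nlinarith [norm_nonneg (ω z)]
    positivity
  have hcast : (2 * (1 - α) : ℂ) = ((2 * (1 - α) : ℝ) : ℂ) := by push_cast; ring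
  rw [heq z hz, halfPlaneMap_eq α hw1, hcast, Complex.add_re, Complex.re_ofReal_mul,
    re_div_one_sub hw1, Complex.one_re]
  nlinarith [mul_pos (sub_pos.2 hα) hpos]

theorem subordinate_halfPlaneMap_of_lt_re {α : ℝ} (hα : α < 1) {g : ℂ → ℂ}
    (hg : DifferentiableOn ℂ g unitDisc) (h0 : g 0 = 1) (h : ∀ z ∈ unitDisc, α < (g z).re) :
    Subordinate g (halfPlaneMap α) := by
  have hne : ∀ z ∈ unitDisc, g z + 1 - 2 * α ≠ 0 := by
    intro z hz hzero
    have := congrArg Complex.re hzero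
    simp at this
    linarith [h z hz]
  -- The self-map of the disc is `h⁻¹ ∘ g`, where `h⁻¹ w = (w - 1) / (w + 1 - 2α)`.
  refine ⟨fun z => (g z - 1) / (g z + 1 - 2 * α),
    (hg.sub_const 1).div ((hg.add_const 1).sub_const _) hne, fun z hz => ?_, by simp [h0],
    fun z hz => ?_⟩
  · rw [mem_unitDisc, norm_div, div_lt_one (norm_pos_iff.2 (hne z hz))]
    refine lt_of_pow_lt_pow_left₀ 2 (norm_nonneg _) ?_
    rw [← Complex.normSq_eq_norm_sq, ← Complex.normSq_eq_norm_sq, Complex.normSq_apply,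
      Complex.normSq_apply]
    simp
    nlinarith [h z hz]
  · have h1 := hne z hz
    have h2 : (1 - α : ℂ) ≠ 0 := by
      exact_mod_cast (sub_pos.2 hα).ne'
    have h3 : (1 : ℂ) - (g z - 1) / (g z + 1 - 2 * α) ≠ 0 := by
      have : (1 : ℂ) - (g z - 1) / (g z + 1 - 2 * α) = 2 * (1 - α) / (g z + 1 - 2 * α) := by
        field_simp
        ring
      rw [this]
      exact div_ne_zero (mul_ne_zero two_ne_zero h2) h1
    rw [halfPlaneMap, eq_div_iff h3]
    field_simp
    ring

/-! ### The power dominant and the solutions of the differential subordination -/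

theorem powerDominant_eq_exp (c : ℂ) {z : ℂ} (hz : z ∈ unitDisc) :
    powerDominant c z = exp (-c * log (1 - z)) := by
  have hne : 1 - z ≠ 0 := sub_ne_zero.2 (ne_one_of_mem_unitDisc hz).symm
  rw [powerDominant, Complex.cpow_def_of_ne_zero hne, one_div, ← Complex.exp_neg]
  ring_nf

theorem hasDerivAt_log_one_sub {z : ℂ} (hz : z ∈ unitDisc) :
    HasDerivAt (fun z => log (1 - z)) (-1 / (1 - z)) z :=
  ((hasDerivAt_id z).const_sub 1).clog (Or.inl (one_sub_re_pos hz))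

theorem differentiableOn_log_one_sub : DifferentiableOn ℂ (fun z => log (1 - z)) unitDisc :=
  fun _ hz => (hasDerivAt_log_one_sub hz).differentiableAt.differentiableWithinAt

theorem differentiableOn_powerDominant (c : ℂ) : DifferentiableOn ℂ (powerDominant c) unitDisc :=
  ((differentiableOn_log_one_sub.const_mul (-c)).cexp).congr
    fun _ hz => powerDominant_eq_exp c hz

/-- A nonzero `c` in the two discs satisfies `1 / 2 ≤ |Re (1 / c)|`, here with denominators
cleared. -/
theorem norm_sq_le_two_mul_abs_re {c : ℂ} (hc : c ∈ twoDiscs) : ‖c‖ ^ 2 ≤ 2 * |c.re| := by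
  have aux : ∀ d : ℂ, ‖d + 1‖ ≤ 1 → ‖d‖ ^ 2 ≤ 2 * |d.re| := by
    intro d hd
    have h1 : ‖d + 1‖ ^ 2 ≤ 1 := pow_le_one₀ (norm_nonneg _) hd
    rw [← Complex.normSq_eq_norm_sq, Complex.normSq_apply] at h1 ⊢
    simp at h1
    nlinarith [neg_abs_le d.re]
  rcases hc with h | h
  · exact aux c h
  · have := aux (-c) (by rwa [neg_add_eq_sub, norm_sub_rev])
    simpa using this

/-- Two values of `log (1 - z)` have imaginary parts less than `π` apart, while the periods of
`s ↦ exp (-c s)` have imaginary parts at least `π` apart when `c` lies in the two discs. -/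
theorem univalent_powerDominant {c : ℂ} (hc : c ∈ twoDiscs) (hc0 : c ≠ 0) :
    Univalent (powerDominant c) := by
  refine ⟨differentiableOn_powerDominant c, fun z hz w hw heq => ?_⟩
  rw [powerDominant_eq_exp c hz, powerDominant_eq_exp c hw, exp_eq_exp_iff_exists_int] at heq
  obtain ⟨n, hn⟩ := heq
  have harg : ∀ u ∈ unitDisc, |(log (1 - u)).im| < Real.pi / 2 := fun u hu => by
    rw [Complex.log_im]
    exact Complex.abs_arg_lt_pi_div_two_iff.2 (Or.inl (one_sub_re_pos hu))
  have hnorm : 0 < ‖c‖ ^ 2 := by positivity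
  have hconj : c * (starRingEnd ℂ) c = ((‖c‖ ^ 2 : ℝ) : ℂ) := by
    rw [Complex.mul_conj, Complex.normSq_eq_norm_sq]
  have hdiff : ((‖c‖ ^ 2 : ℝ) : ℂ) * (log (1 - w) - log (1 - z)) =
      (starRingEnd ℂ) c * (n * (2 * Real.pi * I)) := by
    rw [← hconj]
    linear_combination (starRingEnd ℂ) c * hn
  have him := congrArg Complex.im hdiff
  rw [Complex.im_ofReal_mul] at him
  simp at him
  have hn0 : n = 0 := by
    by_contra hne
    have h1 : (1 : ℝ) ≤ |(n : ℝ)| := by exact_mod_cast Int.one_le_abs hne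
    have h2 : |(log (1 - w)).im - (log (1 - z)).im| < Real.pi :=
      (abs_sub _ _).trans_lt (by linarith [harg z hz, harg w hw])
    have h3 := congrArg abs him
    simp only [abs_mul, abs_of_pos hnorm, abs_of_pos Real.pi_pos, abs_two] at h3
    -- The periods `2πin / c` have imaginary part `2πn Re (1 / c)`, at least `π` in absolute value.
    have h4 := norm_sq_le_two_mul_abs_re hc
    have h5 : ‖c‖ ^ 2 * |(log (1 - w)).im - (log (1 - z)).im| < ‖c‖ ^ 2 * Real.pi := by gcongr
    have h6 : 2 * |c.re| * Real.pi * 1 ≤ 2 * |c.re| * Real.pi * |(n : ℝ)| := by gcongr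
    have h7 : ‖c‖ ^ 2 * Real.pi ≤ 2 * |c.re| * Real.pi := by gcongr
    nlinarith
  have hlog : log (1 - z) = log (1 - w) := by
    rw [hn0] at hn
    refine mul_left_cancel₀ (neg_ne_zero.2 hc0) ?_
    simpa using hn
  have hz1 : 1 - z ≠ 0 := sub_ne_zero.2 (ne_one_of_mem_unitDisc hz).symm
  have hw1 : 1 - w ≠ 0 := sub_ne_zero.2 (ne_one_of_mem_unitDisc hw).symm
  have := congrArg exp hlog
  rw [exp_log hz1, exp_log hw1] at this
  exact sub_right_injective this

/-- Every solution is subordinate to the power dominant: `M = log P / c` satisfies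
`Re (z M') > -1 / 2`, and `P = q ∘ (1 - exp (-M))`. No restriction on `c` is needed here. -/
theorem subordinate_powerDominant_of_mem_solutions {γ c : ℂ} {α : ℝ} (hα : α < 1)
    (hγc : γ * c = 2 * (1 - α)) {P : ℂ → ℂ} (hP : P ∈ solutions γ (halfPlaneMap α)) :
    Subordinate P (powerDominant c) := by
  obtain ⟨hPd, hP0, hPne, hsub⟩ := hP
  obtain ⟨L, hLd, hL0, hL⟩ := exists_normalized_log hPd hP0 hPne
  have hα' : (1 - α : ℂ) ≠ 0 := by exact_mod_cast (sub_pos.2 hα).ne'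
  have hc : c ≠ 0 := by
    rintro rfl
    simp [hα'] at hγc
  have hMd : DifferentiableOn ℂ (fun z => L z / c) unitDisc := hLd.div_const c
  have hM : ∀ z ∈ unitDisc, ‖1 - exp (-(L z / c))‖ < 1 := by
    refine norm_one_sub_exp_neg_lt_one hMd (by simp [hL0]) fun z hz => ?_
    have hLz := (hLd.differentiableAt (isOpen_unitDisc.mem_nhds hz)).hasDerivAt
    have hPz : HasDerivAt P (exp (L z) * deriv L z) z :=
      hLz.cexp.congr_of_eventuallyEq
        ((isOpen_unitDisc.eventually_mem hz).mono fun w hw => (hL w hw).symm)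
    have hre := lt_re_of_subordinate_halfPlaneMap hα hsub z hz
    have hquot : 1 + γ * (z * deriv P z / P z) =
        1 + ((2 * (1 - α) : ℝ) : ℂ) * (z * deriv (fun z => L z / c) z) := by
      rw [hPz.deriv, (hLz.div_const c).deriv, ← hL z hz]
      have := exp_ne_zero (L z)
      push_cast
      rw [← hγc]
      field_simp
    simp only [hquot] at hre
    rw [Complex.add_re, Complex.re_ofReal_mul, Complex.one_re] at hre
    nlinarith
  refine ⟨fun z => 1 - exp (-(L z / c)), hMd.neg.cexp.const_sub 1,
    fun z hz => mem_unitDisc.2 (hM z hz), by simp [hL0], fun z hz => ?_⟩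
  have hωU : ∀ z ∈ unitDisc, 1 - exp (-(L z / c)) ∈ unitDisc := fun z hz =>
    mem_unitDisc.2 (hM z hz)
  have hlog : DifferentiableOn ℂ (fun z => log (1 - (1 - exp (-(L z / c))))) unitDisc :=
    differentiableOn_log_one_sub.comp (hMd.neg.cexp.const_sub 1) hωU
  -- The logarithm `-L / c` of `1 - ω` is the principal one, as both vanish at `0`.
  have heq := eqOn_of_exp_eq hlog hMd.neg (by simp [hL0]) (fun z hz => by
    rw [exp_log (sub_ne_zero.2 (ne_one_of_mem_unitDisc (hωU z hz)).symm), sub_sub_cancel]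
    rfl) hz
  rw [powerDominant_eq_exp c (hωU z hz)]
  simp only at heq
  rw [heq, ← hL z hz]
  congr 1
  simp only [Pi.neg_apply]
  field_simp

theorem powerDominant_mem_solutions {γ c : ℂ} {α : ℝ} (hγc : γ * c = 2 * (1 - α)) :
    powerDominant c ∈ solutions γ (halfPlaneMap α) := by
  refine ⟨differentiableOn_powerDominant c, by simp [powerDominant], fun z hz => ?_,
    fun z => z, differentiableOn_id, fun z hz => hz, rfl, fun z hz => ?_⟩
  · rw [powerDominant_eq_exp c hz]
    exact exp_ne_zero _
  · have hq : HasDerivAt (powerDominant c)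
        (exp (-c * log (1 - z)) * (-c * (-1 / (1 - z)))) z :=
      (((hasDerivAt_log_one_sub hz).const_mul (-c)).cexp).congr_of_eventuallyEq
        ((isOpen_unitDisc.eventually_mem hz).mono fun w hw => powerDominant_eq_exp c hw)
    have h1 : 1 - z ≠ 0 := sub_ne_zero.2 (ne_one_of_mem_unitDisc hz).symm
    have h2 := exp_ne_zero (-c * log (1 - z))
    simp only
    rw [halfPlaneMap_eq α (ne_one_of_mem_unitDisc hz), hq.deriv, powerDominant_eq_exp c hz, ← hγc]
    field_simp

/-- Any set of solutions containing the power dominant has it as best dominant. -/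
theorem isBestDominant_powerDominant {γ c : ℂ} {α : ℝ} (hα : α < 1) (hγc : γ * c = 2 * (1 - α))
    (hc : c ∈ twoDiscs) (hc0 : c ≠ 0) {S : Set (ℂ → ℂ)} (hS : S ⊆ solutions γ (halfPlaneMap α))
    (hq : powerDominant c ∈ S) : IsBestDominant S (powerDominant c) :=
  ⟨univalent_powerDominant hc hc0, ⟨differentiableOn_powerDominant c, fun _ hP =>
    subordinate_powerDominant_of_mem_solutions hα hγc (hS hP)⟩, fun _ hr => hr.2 _ hq⟩

/-! ### The factor `f' / (p z ^ (p - 1))` -/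

theorem differentiableOn_tsum_mul_pow {a : ℕ → ℂ}
    (ha : ∀ z ∈ unitDisc, Summable fun k => a k * z ^ k) :
    DifferentiableOn ℂ (fun z => ∑' k, a k * z ^ k) unitDisc := by
  intro z hz
  obtain ⟨r, hzr, hr1⟩ := exists_between (mem_unitDisc.1 hz)
  have hr0 : 0 < r := (norm_nonneg z).trans_lt hzr
  have hsum : Summable fun k => ‖a k‖ * r ^ k := by
    have := (ha (r : ℂ) (by simpa [mem_unitDisc, abs_of_pos hr0] using hr1)).norm
    simpa [abs_of_pos hr0] using this
  have hd := differentiableOn_tsum_of_summable_norm (F := fun k z => a k * z ^ k) hsum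
    (fun k => ((differentiable_pow k).const_mul (a k)).differentiableOn) Metric.isOpen_ball
    (fun k w hw => by
      rw [norm_mul, norm_pow]
      gcongr
      exact (mem_ball_zero_iff.1 hw).le)
  exact (hd.differentiableAt (Metric.isOpen_ball.mem_nhds
    (mem_ball_zero_iff.2 hzr))).differentiableWithinAt

/-- The class `classA p` without power series: `f(z) = z ^ p + z ^ (p + 1) G(z)`, `G` analytic. -/
theorem mem_classA_iff {p : ℕ} {f : ℂ → ℂ} :
    f ∈ classA p ↔ ∃ G : ℂ → ℂ, DifferentiableOn ℂ G unitDisc ∧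
      ∀ z ∈ unitDisc, f z = z ^ p + z ^ (p + 1) * G z := by
  constructor
  · rintro ⟨-, a, ha⟩
    refine ⟨fun z => ∑' k, a k * z ^ k, differentiableOn_tsum_mul_pow fun z hz => ?_,
      fun z hz => ?_⟩
    · rcases eq_or_ne z 0 with rfl | hz0
      · refine summable_of_ne_finset_zero (s := {0}) fun k hk => ?_
        have hk' : k ≠ 0 := by simpa using hk
        simp [hk']
      · have := (ha z hz).summable.mul_left (z ^ (p + 1))⁻¹
        refine this.congr fun k => ?_
        rw [pow_add z (p + 1) k]
        field_simp
    · rw [← tsum_mul_left, ← sub_eq_iff_eq_add', ← (ha z hz).tsum_eq]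
      refine tsum_congr fun k => ?_
      ring
  · rintro ⟨G, hG, hf⟩
    refine ⟨((differentiable_pow p).differentiableOn.add
      ((differentiable_pow (p + 1)).differentiableOn.mul hG)).congr hf,
      fun k => (k.factorial : ℂ)⁻¹ * iteratedDeriv k G 0, fun z hz => ?_⟩
    have := (Complex.hasSum_taylorSeries_on_ball hG hz).mul_left (z ^ (p + 1))
    rw [hf z hz, add_sub_cancel_left]
    have hterm : ∀ k : ℕ, z ^ (p + 1) * ((k.factorial : ℂ)⁻¹ • (z - 0) ^ k • iteratedDeriv k G 0) =
        (k.factorial : ℂ)⁻¹ * iteratedDeriv k G 0 * z ^ (p + 1 + k) := fun k => by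
      simp only [smul_eq_mul, sub_zero]
      ring
    simpa only [hterm] using this

/-- The quotient `u / z ^ (m + 1)` is bounded near `0` by the mean value inequality, so its
singularity is removable: if `u' = z ^ m v` and `u` vanishes at `0`, then `u` is divisible by
`z ^ (m + 1)`. -/
theorem exists_eq_pow_mul_of_hasDerivAt {u v : ℂ → ℂ} {m : ℕ}
    (hv : DifferentiableOn ℂ v unitDisc) (hu0 : u 0 = 0)
    (hu : ∀ z ∈ unitDisc, HasDerivAt u (z ^ m * v z) z) :
    ∃ G : ℂ → ℂ, DifferentiableOn ℂ G unitDisc ∧ ∀ z ∈ unitDisc, u z = z ^ (m + 1) * G z := by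
  have hnhds : unitDisc ∈ 𝓝 (0 : ℂ) := isOpen_unitDisc.mem_nhds zero_mem_unitDisc
  obtain ⟨δ, hδ, hbound⟩ : ∃ δ > 0, ∀ z ∈ Metric.ball (0 : ℂ) δ,
      z ∈ unitDisc ∧ ‖v z‖ ≤ ‖v 0‖ + 1 := by
    have h1 : ∀ᶠ z in 𝓝 (0 : ℂ), ‖v z‖ < ‖v 0‖ + 1 :=
      (hv.differentiableAt hnhds).continuousAt.norm.eventually_lt_const (lt_add_one _)
    obtain ⟨δ, hδ, h⟩ := Metric.eventually_nhds_iff_ball.1 (h1.and hnhds)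
    exact ⟨δ, hδ, fun z hz => ⟨(h z hz).2, (h z hz).1.le⟩⟩
  have hest : ∀ z ∈ Metric.ball (0 : ℂ) δ, ‖u z‖ ≤ (‖v 0‖ + 1) * ‖z‖ ^ (m + 1) := by
    intro z hz
    have hsub : ∀ w ∈ Metric.closedBall (0 : ℂ) ‖z‖, w ∈ Metric.ball (0 : ℂ) δ := fun w hw =>
      mem_ball_zero_iff.2 ((mem_closedBall_zero_iff.1 hw).trans_lt (mem_ball_zero_iff.1 hz))
    have := (convex_closedBall (0 : ℂ) ‖z‖).norm_image_sub_le_of_norm_hasDerivWithin_le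
      (f := u) (C := ‖z‖ ^ m * (‖v 0‖ + 1)) (x := 0) (y := z)
      (fun w hw => (hu w (hbound w (hsub w hw)).1).hasDerivWithinAt)
      (fun w hw => by
        rw [norm_mul, norm_pow]
        gcongr
        · exact mem_closedBall_zero_iff.1 hw
        · exact (hbound w (hsub w hw)).2) (by simp) (by simp)
    rw [hu0, sub_zero, sub_zero] at this
    exact this.trans_eq (by ring)
  have hud : DifferentiableOn ℂ (fun z => u z / z ^ (m + 1)) (unitDisc \ {0}) := fun z hz =>
    ((hu z hz.1).differentiableAt.div (differentiableAt_pow _)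
      (pow_ne_zero _ hz.2)).differentiableWithinAt
  have hbdd : IsBoundedUnder (· ≤ ·) (𝓝[≠] (0 : ℂ))
      (fun z => ‖u z / z ^ (m + 1) - u 0 / 0 ^ (m + 1)‖) := by
    refine ⟨‖v 0‖ + 1, eventually_map.2 ?_⟩
    filter_upwards [mem_nhdsWithin_of_mem_nhds (Metric.ball_mem_nhds (0 : ℂ) hδ),
      self_mem_nhdsWithin] with z hz hz0
    have hz0' : z ≠ 0 := hz0
    rw [hu0, zero_div, sub_zero, norm_div, norm_pow, div_le_iff₀ (by positivity)]
    exact hest z hz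
  refine ⟨_, differentiableOn_update_limUnder_of_isLittleO hnhds hud hbdd.isLittleO_sub_self_inv,
    fun z _ => ?_⟩
  rcases eq_or_ne z 0 with rfl | hz0
  · simp [hu0]
  · rw [Function.update_of_ne hz0]
    field_simp

/-- The factor `g` in `f' = p z ^ (p - 1) g`, `p = n + 1`, is analytic at the origin too. -/
theorem exists_derivQuotient {n : ℕ} {f : ℂ → ℂ} (hf : f ∈ classA (n + 1)) :
    DifferentiableOn ℂ (derivQuotient (n + 1) f) unitDisc ∧
      ∀ z ∈ unitDisc, deriv f z = (n + 1) * z ^ n * derivQuotient (n + 1) f z := by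
  obtain ⟨G, hG, hfG⟩ := mem_classA_iff.1 hf
  have hn : (n + 1 : ℂ) ≠ 0 := by exact_mod_cast n.succ_ne_zero
  set g : ℂ → ℂ := fun z => 1 + ((n + 2) * z * G z + z ^ 2 * deriv G z) / (n + 1) with hg
  have hderiv : ∀ z ∈ unitDisc, deriv f z = (n + 1) * z ^ n * g z := by
    intro z hz
    have hGz := (hG.differentiableAt (isOpen_unitDisc.mem_nhds hz)).hasDerivAt
    have hfz : HasDerivAt f _ z :=
      ((hasDerivAt_pow (n + 1) z).add ((hasDerivAt_pow (n + 2) z).mul hGz)).congr_of_eventuallyEq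
        ((isOpen_unitDisc.eventually_mem hz).mono hfG)
    rw [hfz.deriv, hg]
    simp only [Nat.add_sub_cancel, Nat.add_succ_sub_one]
    push_cast
    field_simp
    ring
  have heq : ∀ z ∈ unitDisc, derivQuotient (n + 1) f z = g z := by
    intro z hz
    rcases eq_or_ne z 0 with rfl | hz0
    · simp [derivQuotient, hg]
    · rw [derivQuotient, if_neg hz0, hderiv z hz, Nat.add_sub_cancel]
      push_cast
      field_simp
  refine ⟨DifferentiableOn.congr ?_ heq, fun z hz => by rw [heq z hz, hderiv z hz]⟩
  have hG' := hG.deriv isOpen_unitDisc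
  fun_prop

theorem derivQuotient_zero (p : ℕ) (f : ℂ → ℂ) : derivQuotient p f 0 = 1 := if_pos rfl

theorem derivNonvanishing_iff {n : ℕ} {f : ℂ → ℂ} (hf : f ∈ classA (n + 1)) :
    DerivNonvanishing f ↔ ∀ z ∈ unitDisc, derivQuotient (n + 1) f z ≠ 0 := by
  have hn : (n + 1 : ℂ) ≠ 0 := by exact_mod_cast n.succ_ne_zero
  constructor
  · intro h z hz
    rcases eq_or_ne z 0 with rfl | hz0
    · rw [derivQuotient_zero]
      exact one_ne_zero
    · have := h z hz hz0
      rw [(exists_derivQuotient hf).2 z hz] at this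
      exact right_ne_zero_of_mul this
  · intro h z hz hz0
    rw [(exists_derivQuotient hf).2 z hz]
    exact mul_ne_zero (mul_ne_zero hn (pow_ne_zero _ hz0)) (h z hz)

theorem convexityQuotient_eq {n : ℕ} {f : ℂ → ℂ} (hf : f ∈ classA (n + 1))
    (hne : DerivNonvanishing f) {z : ℂ} (hz : z ∈ unitDisc) :
    convexityQuotient (n + 1) f z =
      (n + 1) + z * deriv (derivQuotient (n + 1) f) z / derivQuotient (n + 1) f z := by
  rcases eq_or_ne z 0 with rfl | hz0
  · simp [convexityQuotient]
  obtain ⟨hg, hderiv⟩ := exists_derivQuotient hf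
  have hn : (n + 1 : ℂ) ≠ 0 := by exact_mod_cast n.succ_ne_zero
  have hgz := (hg.differentiableAt (isOpen_unitDisc.mem_nhds hz)).hasDerivAt
  have hf2 : HasDerivAt (deriv f) _ z :=
    (((hasDerivAt_pow n z).const_mul (n + 1 : ℂ)).mul hgz).congr_of_eventuallyEq
      ((isOpen_unitDisc.eventually_mem hz).mono hderiv)
  have h1 := (derivNonvanishing_iff hf).1 hne z hz
  have h2 : (n : ℂ) * z ^ (n - 1) * z = n * z ^ n := by
    cases n with
    | zero => simp
    | succ k => rw [Nat.add_sub_cancel, pow_succ, mul_assoc]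
  rw [convexityQuotient, if_neg hz0, hf2.deriv, hderiv z hz]
  field_simp
  linear_combination derivQuotient (n + 1) f z * h2

/-- Every analytic `g` with `g(0) = 1` is the factor of `f' = p z ^ (p - 1) g`, `p = n + 1`, for
some `f` in the class. -/
theorem exists_mem_classA_derivQuotient_eq (n : ℕ) {g : ℂ → ℂ}
    (hg : DifferentiableOn ℂ g unitDisc) (h0 : g 0 = 1) :
    ∃ f ∈ classA (n + 1), ∀ z ∈ unitDisc, derivQuotient (n + 1) f z = g z := by
  have hn : (n + 1 : ℂ) ≠ 0 := by exact_mod_cast n.succ_ne_zero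
  have hnhds : unitDisc ∈ 𝓝 (0 : ℂ) := isOpen_unitDisc.mem_nhds zero_mem_unitDisc
  obtain ⟨f, hf0, hf⟩ := exists_primitive
    ((((differentiable_pow n).differentiableOn (s := unitDisc)).const_mul (n + 1 : ℂ)).mul hg)
  have hslope : DifferentiableOn ℂ (dslope g 0) unitDisc :=
    (Complex.differentiableOn_dslope hnhds).2 hg
  have hgs : ∀ z, g z = 1 + z * dslope g 0 z := by
    intro z
    have := sub_smul_dslope g 0 z
    rw [h0, sub_zero, smul_eq_mul] at this
    rw [this]
    ring
  obtain ⟨G, hG, hfG⟩ := exists_eq_pow_mul_of_hasDerivAt (m := n + 1)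
    (u := fun z => f z - z ^ (n + 1)) (hslope.const_mul (n + 1 : ℂ)) (by simp [hf0])
    (fun z hz => by
      refine ((hf z hz).sub (hasDerivAt_pow (n + 1) z)).congr_deriv ?_
      simp only [Pi.mul_apply, Nat.add_sub_cancel]
      rw [hgs z]
      push_cast
      ring)
  refine ⟨f, mem_classA_iff.2 ⟨G, hG, fun z hz => ?_⟩, fun z hz => ?_⟩
  · rw [← hfG z hz]
    ring
  · rcases eq_or_ne z 0 with rfl | hz0
    · rw [derivQuotient_zero, h0]
    · rw [derivQuotient, if_neg hz0, (hf z hz).deriv, Nat.add_sub_cancel]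
      simp only [Pi.mul_apply]
      push_cast
      field_simp

/-! ### Powers of the factor as solutions -/

/-- The expression that defines the class `classK` is the one in its subordination form. -/
theorem robertson_expression_eq {lam : ℝ} (hcos : Real.cos lam ≠ 0) {b : ℂ} (hb : b ≠ 0)
    (p : ℕ) (C : ℂ) :
    1 / (b * Real.cos lam) *
        (exp (I * lam) / p * C - (1 - b) * Real.cos lam - I * Real.sin lam) =
      1 + exp (I * lam) / (b * Real.cos lam) * ((1 / p) * C - 1) := by
  have hcos' : (Real.cos lam : ℂ) ≠ 0 := by exact_mod_cast hcos
  have hexp : exp (I * lam) = Real.cos lam + I * Real.sin lam := by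
    rw [mul_comm, Complex.exp_mul_I]
    push_cast
    ring
  have h1 : exp (I * lam) / p * C - (1 - b) * Real.cos lam - I * Real.sin lam =
      b * Real.cos lam + exp (I * lam) * ((1 / p) * C - 1) := by
    linear_combination hexp
  rw [h1]
  field_simp

/-- The half-plane map sends the disc onto `Re w > α`, and
`z ↦ p + z g'(z) / g(z)`, `g` the analytic factor of `f'`, has no singularity at `0`. -/
theorem mem_classK_iff {n : ℕ} {lam α : ℝ} (hcos : Real.cos lam ≠ 0) (hα : α < 1) {b : ℂ}
    (hb : b ≠ 0) {f : ℂ → ℂ} (hf : f ∈ classA (n + 1)) :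
    f ∈ classK (n + 1) lam α b ↔ RobertsonSubordination (n + 1) lam α b f := by
  have hn : ((n + 1 : ℕ) : ℂ) ≠ 0 := by exact_mod_cast n.succ_ne_zero
  constructor
  · rintro ⟨-, hne, hre⟩
    refine ⟨hne, subordinate_halfPlaneMap_of_lt_re hα ?_ ?_ fun z hz => ?_⟩
    · obtain ⟨hg, -⟩ := exists_derivQuotient hf
      have hg' := hg.deriv isOpen_unitDisc
      have hC : DifferentiableOn ℂ (convexityQuotient (n + 1) f) unitDisc :=
        (((differentiableOn_id.mul hg').div hg ((derivNonvanishing_iff hf).1 hne)).const_add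
          (n + 1 : ℂ)).congr fun z hz => convexityQuotient_eq hf hne hz
      fun_prop
    · simp only [convexityQuotient, if_true]
      rw [one_div, inv_mul_cancel₀ hn, sub_self, mul_zero, add_zero]
    · simpa only [robertson_expression_eq hcos hb] using hre z hz
  · rintro ⟨hne, hsub⟩
    refine ⟨hf, hne, fun z hz => ?_⟩
    simpa only [robertson_expression_eq hcos hb] using
      lt_re_of_subordinate_halfPlaneMap hα hsub z hz

/-- Logarithmic differentiation of `F = (f' / (p z ^ (p - 1))) ^ a`. -/
theorem IsNormalizedPower.one_add_eq {n : ℕ} {lam : ℝ} {a b : ℂ} (ha : a ≠ 0) {f F : ℂ → ℂ}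
    (hf : f ∈ classA (n + 1)) (hF : IsNormalizedPower (derivQuotient (n + 1) f) a F) {z : ℂ}
    (hz : z ∈ unitDisc) :
    1 + exp (I * lam) / ((n + 1 : ℕ) * a * b * Real.cos lam) * (z * deriv F z / F z) =
      1 + exp (I * lam) / (b * Real.cos lam) *
        ((1 / (n + 1 : ℕ)) * convexityQuotient (n + 1) f z - 1) := by
  obtain ⟨L, hLd, -, hexp, hFL⟩ := hF
  have hn : (n + 1 : ℂ) ≠ 0 := by exact_mod_cast n.succ_ne_zero
  have hne : DerivNonvanishing f := (derivNonvanishing_iff hf).2 fun w hw => by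
    rw [← hexp w hw]
    exact exp_ne_zero _
  have hev := isOpen_unitDisc.eventually_mem hz
  have hLz := (hLd.differentiableAt (isOpen_unitDisc.mem_nhds hz)).hasDerivAt
  have hFz : HasDerivAt F (exp (a * L z) * (a * deriv L z)) z :=
    ((hLz.const_mul a).cexp).congr_of_eventuallyEq (hev.mono hFL)
  have hgz : HasDerivAt (derivQuotient (n + 1) f) (exp (L z) * deriv L z) z :=
    hLz.cexp.congr_of_eventuallyEq (hev.mono fun w hw => (hexp w hw).symm)
  have h1 := exp_ne_zero (L z)
  have h2 := exp_ne_zero (a * L z)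
  have h3 : z * deriv F z / F z = a * (z * deriv L z) := by
    rw [hFz.deriv, hFL z hz]
    field_simp
  have h4 : convexityQuotient (n + 1) f z = (n + 1) + z * deriv L z := by
    rw [convexityQuotient_eq hf hne hz, hgz.deriv, ← hexp z hz]
    field_simp
  rw [h3, h4]
  push_cast
  have h5 : (1 / (n + 1 : ℂ)) * ((n + 1) + z * deriv L z) - 1 = z * deriv L z / (n + 1) := by
    field_simp
    ring
  rw [h5]
  congr 1
  rw [div_mul_div_comm, div_mul_eq_mul_div, ← mul_div_mul_left _ (b * cos lam * (n + 1)) ha]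
  congr 1 <;> ring

theorem robertsonPowers_subset_solutions {n : ℕ} {lam α : ℝ} {a b : ℂ} (ha : a ≠ 0) :
    robertsonPowers (n + 1) lam α a b ⊆
      solutions (exp (I * lam) / ((n + 1 : ℕ) * a * b * Real.cos lam)) (halfPlaneMap α) := by
  rintro F ⟨f, hf, ⟨-, ω, hω, hmaps, hω0, heq⟩, hF⟩
  have hF' := hF
  obtain ⟨L, hLd, hL0, -, hFL⟩ := hF
  refine ⟨(hLd.const_mul a).cexp.congr hFL, ?_, fun z hz => ?_, ω, hω, hmaps, hω0,
    fun z hz => ?_⟩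
  · rw [hFL 0 zero_mem_unitDisc, hL0, mul_zero, exp_zero]
  · rw [hFL z hz]
    exact exp_ne_zero _
  · simp only [hF'.one_add_eq ha hf hz]
    exact heq z hz

/-- The function `f` with `f' = p z ^ (p - 1) (1 - z) ^ (-c / a)` has the power dominant as its
power. -/
theorem powerDominant_mem_robertsonPowers {n : ℕ} {lam α : ℝ} {a b c : ℂ} (ha : a ≠ 0)
    (hc : exp (I * lam) / ((n + 1 : ℕ) * a * b * Real.cos lam) * c = 2 * (1 - α)) :
    powerDominant c ∈ robertsonPowers (n + 1) lam α a b := by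
  set L : ℂ → ℂ := fun z => -c / a * log (1 - z) with hL
  have hLd : DifferentiableOn ℂ L unitDisc := differentiableOn_log_one_sub.const_mul _
  obtain ⟨f, hf, hfg⟩ := exists_mem_classA_derivQuotient_eq n hLd.cexp (by simp [hL])
  have hpow : IsNormalizedPower (derivQuotient (n + 1) f) a (powerDominant c) :=
    ⟨L, hLd, by simp [hL], fun z hz => (hfg z hz).symm, fun z hz => by
      rw [powerDominant_eq_exp c hz, hL]
      congr 1
      field_simp⟩
  obtain ⟨-, -, -, ω, hω, hmaps, hω0, heq⟩ := powerDominant_mem_solutions hc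
  refine ⟨f, hf, ⟨(derivNonvanishing_iff hf).2 fun z hz => ?_, ω, hω, hmaps, hω0,
    fun z hz => ?_⟩, hpow⟩
  · rw [hfg z hz]
    exact exp_ne_zero _
  · rw [← heq z hz]
    exact (hpow.one_add_eq ha hf hz).symm

theorem exists_isNormalizedPower {n : ℕ} (a : ℂ) {f : ℂ → ℂ} (hf : f ∈ classA (n + 1))
    (hne : DerivNonvanishing f) :
    ∃ F, IsNormalizedPower (derivQuotient (n + 1) f) a F := by
  obtain ⟨L, hLd, hL0, hL⟩ := exists_normalized_log (exists_derivQuotient hf).1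
    (derivQuotient_zero _ f) ((derivNonvanishing_iff hf).1 hne)
  exact ⟨fun z => exp (a * L z), L, hLd, hL0, hL, fun _ _ => rfl⟩

theorem mul_robertsonExponent {p : ℕ} (hp : p ≠ 0) {lam α : ℝ} (hcos : Real.cos lam ≠ 0) {a b : ℂ}
    (ha : a ≠ 0) (hb : b ≠ 0) :
    exp (I * lam) / (p * a * b * Real.cos lam) * robertsonExponent p lam α a b =
      2 * (1 - α) := by
  have hcos' : (Real.cos lam : ℂ) ≠ 0 := by exact_mod_cast hcos
  have hp' : (p : ℂ) ≠ 0 := by exact_mod_cast hp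
  have hexp := exp_ne_zero (I * lam)
  rw [robertsonExponent, Complex.exp_neg]
  field_simp

end Robertson

theorem mainTheorem6 (p : ℕ) (hp : 1 ≤ p) (lam α : ℝ) (hlam : |lam| < Real.pi / 2)
    (hα0 : 0 ≤ α) (hα1 : α < 1) (a b : ℂ) (ha : a ≠ 0) (hb : b ≠ 0)
    (hc : Robertson.robertsonExponent p lam α a b ∈ Robertson.twoDiscs) :
    (∀ f ∈ Robertson.classK p lam α b,
      ∃ F : ℂ → ℂ, Robertson.IsNormalizedPower (Robertson.derivQuotient p f) a F ∧
        Robertson.Subordinate F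
          (Robertson.powerDominant (Robertson.robertsonExponent p lam α a b))) ∧
    (∀ f ∈ Robertson.classA p,
      (f ∈ Robertson.classK p lam α b ↔ Robertson.RobertsonSubordination p lam α b f)) ∧
    (∀ f ∈ Robertson.classA p, Robertson.RobertsonSubordination p lam α b f →
      ∃ F : ℂ → ℂ, Robertson.IsNormalizedPower (Robertson.derivQuotient p f) a F ∧
        Robertson.Subordinate F
          (Robertson.powerDominant (Robertson.robertsonExponent p lam α a b))) ∧
    Robertson.IsBestDominant (Robertson.robertsonPowers p lam α a b)
      (Robertson.powerDominant (Robertson.robertsonExponent p lam α a b)) ∧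
    Robertson.IsBestDominant
      (Robertson.solutions (Complex.exp (Complex.I * lam) / (p * a * b * Real.cos lam))
        (Robertson.halfPlaneMap α))
      (Robertson.powerDominant (Robertson.robertsonExponent p lam α a b)) := by
  -- With `p = n + 1` the exponent `p - 1` is free of truncated subtraction.
  obtain ⟨n, rfl⟩ : ∃ n, p = n + 1 := ⟨p - 1, by omega⟩
  have hcos : Real.cos lam ≠ 0 := (Real.cos_pos_of_mem_Ioo (abs_lt.1 hlam)).ne'
  have hγc := Robertson.mul_robertsonExponent (α := α) n.succ_ne_zero hcos ha hb
  have hc0 : Robertson.robertsonExponent (n + 1) lam α a b ≠ 0 := by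
    intro h
    have hα' : (1 - α : ℂ) ≠ 0 := by exact_mod_cast (sub_pos.2 hα1).ne'
    rw [h, mul_zero] at hγc
    exact mul_ne_zero two_ne_zero hα' hγc.symm
  have hiff : ∀ f ∈ Robertson.classA (n + 1), (f ∈ Robertson.classK (n + 1) lam α b ↔
      Robertson.RobertsonSubordination (n + 1) lam α b f) :=
    fun f hf => Robertson.mem_classK_iff hcos hα1 hb hf
  have hsub : ∀ f ∈ Robertson.classA (n + 1), Robertson.RobertsonSubordination (n + 1) lam α b f →
      ∃ F : ℂ → ℂ, Robertson.IsNormalizedPower (Robertson.derivQuotient (n + 1) f) a F ∧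
        Robertson.Subordinate F
          (Robertson.powerDominant (Robertson.robertsonExponent (n + 1) lam α a b)) := by
    intro f hf hfs
    obtain ⟨F, hF⟩ := Robertson.exists_isNormalizedPower a hf hfs.1
    exact ⟨F, hF, Robertson.subordinate_powerDominant_of_mem_solutions hα1 hγc
      (Robertson.robertsonPowers_subset_solutions ha ⟨f, hf, hfs, hF⟩)⟩
  exact ⟨fun f hf => hsub f hf.1 ((hiff f hf.1).1 hf), hiff, hsub,
    Robertson.isBestDominant_powerDominant hα1 hγc hc hc0
      (Robertson.robertsonPowers_subset_solutions ha)
      (Robertson.powerDominant_mem_robertsonPowers ha hγc),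
    Robertson.isBestDominant_powerDominant hα1 hγc hc hc0 subset_rfl
      (Robertson.powerDominant_mem_solutions hγc)⟩
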